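/- Let $\mathbb F$ be a field of characteristic different from $2$. A family is a sequence $(f_n)_{n\in\mathbb N}$ of polynomials over $\mathbb F$ in variables $x_1,x_2,\dots$; a class is a set of families; $\mathrm{poly}(n)$ denotes the set of polynomially bounded functions $\mathbb N\to\mathbb N$. For a class $\mathbf C$, let $\mathrm N(\mathbf C)$ be the class of families $(f_n)$ for which there are $(g_n)\in\mathbf C$ and $p(n),q(n)\in\mathrm{poly}(n)$ with $$f_n(\mathbf x)=\sum_{\mathbf b\in\{0,1\}^{p(n)}} g_{q(n)}(\mathbf b,\mathbf x)\quad\text{for all } n.$$ Let $\mathbf{VP}$ be the class of families $(f_n)$ such that the number of variables and the degree of $f_n$ are polynomially bounded and $f_n$ is computed by arithmetic circuits over $\mathbb F$ of polynomially bounded size, and let $\mathbf{VNP}=\mathrm N(\mathbf{VP})$. An algebraic branching program (ABP) is a directed graph with a source $s$ and a sink $t$ whose vertices are partitioned into layers numbered by integers, whose edges go from a layer $i$ to layer $i+1$ and are labeled by affine linear forms; its width is the size of its largest layer, its size is the number of its vertices, and it computes the sum over all $s$-$t$-paths of the product of the edge labels. Let $\mathbf{VP}_1^{\mathrm{weak}}$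 (respectively $\mathbf{VP}_1^{\mathrm{weak}+}$) be the class of families in polynomially many variables that are computed by width-$1$ ABPs of polynomially bounded size all of whose edge labels have the form $\alpha x_i+\beta$ (respectively $\alpha x_i+\beta x_j+\gamma$) with $\alpha,\beta,\gamma\in\mathbb F$, and let $\mathbf{VNP}_1^{\mathrm{weak}}=\mathrm N(\mathbf{VP}_1^{\mathrm{weak}})$ and $\mathbf{VNP}_1^{\mathrm{weak}+}=\mathrm N(\mathbf{VP}_1^{\mathrm{weak}+})$. Then $$\mathbf{VNP}_1^{\mathrm{weak}}\subsetneq\mathbf{VNP}_1^{\mathrm{weak}+}=\mathbf{VNP}.$$ In particular, a family $(f_n)$ is in $\mathbf{VNP}$ if and only if there are $p(n),m(n)\in\mathrm{poly}(n)$ such that for every $n$ there are affine linear forms $\ell_{n,1},\dots,\ell_{n,m(n)}$ over $\mathbb F$, each in at most two variables, with $$f_n(\mathbf x)=\sum_{\mathbf b\in\{0,1\}^{p(n)}}\prod_{i=1}^{m(n)}\ell_{n,i}(\mathbf b,\mathbf x).$$ -/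

import Mathlib

namespace AlgComplexity

/-- `t` is polynomially bounded: `t n ≤ P(n)` for a fixed polynomial `P`. -/
def PolyBounded (t : ℕ → ℕ) : Prop :=
  ∃ P : Polynomial ℕ, ∀ n, t n ≤ P.eval n

/-- A family: a sequence of polynomials over `F` in the variables `x₀, x₁, x₂, …`. -/
abbrev Family (F : Type*) [Field F] := ℕ → MvPolynomial ℕ F

/-- A family in polynomially many variables: the number of variables that occur in `f n`
is polynomially bounded in `n`. -/
def PolyManyVars {F : Type*} [Field F] (f : Family F) : Prop :=
  PolyBounded fun n => (f n).vars.card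

/-- Gates of an arithmetic circuit: constants, variables, and fan-in 2 additions and
multiplications of two of the first `m` gates. -/
inductive Gate (F : Type*) (m : ℕ)
  | const (a : F) : Gate F m
  | var (i : ℕ) : Gate F m
  | add (j k : Fin m) : Gate F m
  | mul (j k : Fin m) : Gate F m

/-- An arithmetic circuit over `F`: a directed acyclic graph of gates, listed in a topological
order (the arguments of gate `i` are gates with a smaller index). The size counts all gates,
input gates included; gates may be reused any number of times. -/
structure Circuit (F : Type*) where
  size : ℕ
  gate : (i : Fin size) → Gate F i
  output : Fin size

/-- The polynomial computed at gate `i`. -/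
noncomputable def Circuit.gateValue {F : Type*} [Field F] (Γ : Circuit F) (i : Fin Γ.size) :
    MvPolynomial ℕ F :=
  match Γ.gate i with
  | .const a => MvPolynomial.C a
  | .var v => MvPolynomial.X v
  | .add j k => Γ.gateValue ⟨j, j.2.trans i.2⟩ + Γ.gateValue ⟨k, k.2.trans i.2⟩
  | .mul j k => Γ.gateValue ⟨j, j.2.trans i.2⟩ * Γ.gateValue ⟨k, k.2.trans i.2⟩
termination_by i.val
decreasing_by all_goals exact Fin.isLt _

/-- The polynomial computed by a circuit. -/
noncomputable def Circuit.value {F : Type*} [Field F] (Γ : Circuit F) : MvPolynomial ℕ F :=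
  Γ.gateValue Γ.output

/-- `VP`: families with polynomially many variables, polynomially bounded degree, and
arithmetic circuits of polynomially bounded size. -/
def VP (F : Type*) [Field F] : Set (Family F) :=
  {f | PolyManyVars f ∧ PolyBounded (fun n => (f n).totalDegree) ∧
    ∃ Γ : ℕ → Circuit F, PolyBounded (fun n => (Γ n).size) ∧ ∀ n, (Γ n).value = f n}

/-- `∑_{b ∈ {0,1}^p} g(b, x)`: the first `p` variables of `g` are the hypercube variables
`b₀, …, b_{p-1}`, and the remaining ones are `x₀, x₁, …`. -/
noncomputable def hypercubeSum {F : Type*} [Field F] (p : ℕ) (g : MvPolynomial ℕ F) :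
    MvPolynomial ℕ F :=
  ∑ b : Fin p → Bool,
    MvPolynomial.bind₁
      (fun i => if h : i < p then (if b ⟨i, h⟩ then 1 else 0) else MvPolynomial.X (i - p)) g

/-- The nondeterminism closure `N(𝒞)` of a class `𝒞`. -/
def N {F : Type*} [Field F] (𝒞 : Set (Family F)) : Set (Family F) :=
  {f | ∃ g ∈ 𝒞, ∃ p q : ℕ → ℕ, PolyBounded p ∧ PolyBounded q ∧
    ∀ n, f n = hypercubeSum (p n) (g (q n))}

/-- `VNP`, the nondeterminism closure of `VP`. -/
def VNP (F : Type*) [Field F] : Set (Family F) := N (VP F)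

/-- An algebraic branching program: a directed graph with edge labels, a source vertex and a
sink vertex, and a layer for every vertex, such that every edge goes from a layer to the next
one (so that the graph is acyclic). The kind of labels allowed is specified separately. -/
structure ABP (F : Type*) [Field F] where
  /-- the number of vertices -/
  size : ℕ
  Adj : Fin size → Fin size → Prop
  label : Fin size → Fin size → MvPolynomial ℕ F
  layer : Fin size → ℤ
  source : Fin size
  sink : Fin size
  layer_of_adj : ∀ u v, Adj u v → layer v = layer u + 1
  not_adj_source : ∀ u, ¬ Adj u source
  not_sink_adj : ∀ u, ¬ Adj sink u

/-- The width of an ABP: the cardinality of its largest layer. -/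
def ABP.width {F : Type*} [Field F] (Γ : ABP F) : ℕ :=
  Finset.univ.sup fun v => (Finset.univ.filter fun u => Γ.layer u = Γ.layer v).card

/-- All edge labels of the ABP belong to `L`. -/
def ABP.LabelsIn {F : Type*} [Field F] (Γ : ABP F) (L : Set (MvPolynomial ℕ F)) : Prop :=
  ∀ u v, Γ.Adj u v → Γ.label u v ∈ L

/-- The number of edges of each path from the source to the sink: an edge raises the layer
by one. (If the sink lies in a lower layer than the source, there is no such path at all.) -/
def ABP.pathLength {F : Type*} [Field F] (Γ : ABP F) : ℕ :=
  (Γ.layer Γ.sink - Γ.layer Γ.source).toNat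

/-- The vertex sequence `π` is a path from the source to the sink. -/
def ABP.IsPath {F : Type*} [Field F] (Γ : ABP F) (π : Fin (Γ.pathLength + 1) → Fin Γ.size) :
    Prop :=
  π 0 = Γ.source ∧ π (Fin.last _) = Γ.sink ∧
    ∀ i : Fin Γ.pathLength, Γ.Adj (π i.castSucc) (π i.succ)

open Classical in
/-- The polynomial computed by an ABP: the sum over all paths from the source to the sink of
the product of the edge labels along the path. -/
noncomputable def ABP.value {F : Type*} [Field F] (Γ : ABP F) : MvPolynomial ℕ F :=
  ∑ π ∈ Finset.univ.filter Γ.IsPath,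
    ∏ i : Fin Γ.pathLength, Γ.label (π i.castSucc) (π i.succ)

/-- Families in polynomially many variables computed by ABPs of width at most `k` and of
polynomially bounded size with edge labels in `L`. -/
def VPwidth {F : Type*} [Field F] (k : ℕ) (L : Set (MvPolynomial ℕ F)) : Set (Family F) :=
  {f | PolyManyVars f ∧ ∃ Γ : ℕ → ABP F, PolyBounded (fun n => (Γ n).size) ∧
    ∀ n, (Γ n).width ≤ k ∧ (Γ n).LabelsIn L ∧ (Γ n).value = f n}

open MvPolynomial in
/-- Simple affine linear forms `α xᵢ + β`. -/
def weakForms (F : Type*) [Field F] : Set (MvPolynomial ℕ F) :=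
  {ℓ | ∃ (α β : F) (i : ℕ), ℓ = C α * X i + C β}

open MvPolynomial in
/-- Affine linear forms `α xᵢ + β xⱼ + γ` in at most two variables. -/
def weakPlusForms (F : Type*) [Field F] : Set (MvPolynomial ℕ F) :=
  {ℓ | ∃ (α β γ : F) (i j : ℕ), ℓ = C α * X i + C β * X j + C γ}

/-- `VNP₁^weak`. -/
def VNP1weak (F : Type*) [Field F] : Set (Family F) := N (VPwidth 1 (weakForms F))

/-- `VNP₁^{weak+}`. -/
def VNP1weakPlus (F : Type*) [Field F] : Set (Family F) := N (VPwidth 1 (weakPlusForms F))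

end AlgComplexity

/-! Let `𝒮` be the class of families of hypercube sums of products of affine forms in at most two
variables (`SumProdFamilies`). A branching program of width one has at most one path, so that it
computes a product of labels; this gives `𝒮 ⊆ VNP₁^{weak+} ⊆ VNP`, and it shows that the members of
`VNP₁^weak` are products of univariate polynomials, which `x₀ + x₁` is not. The content of the
theorem is `VNP ⊆ 𝒮`. As hypercube sums can be nested, it suffices to write a polynomial of degree
`d` with a circuit of size `s` as a hypercube sum of size polynomial in `s` and `d`.

The circuit is first made homogeneous and multiplicatively disjoint (`Circuit.program`): the
component of degree `e > 0` of a gate gets a separate copy for each interval of length `e` in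
`[0, d)`, and a product of degrees `e₁` and `e₂` refers to the copies for the two parts of its
interval. Hence no monomial of a rule, nor of any polynomial obtained by substituting rules into
each other, contains an instruction twice.

Next, each instruction `u` gets a Boolean variable `y u`. With the value `r` of the rule of `u` at
`y`, the weight of `u` is `r` if `y u = 1` and `1 - r` if `y u = 0`. For a multilinear polynomial,
summing over `y u` with these weights is the same as substituting the rule for `y u`; therefore the
sum over all `y` of the product of all weights and `y root` is the value of the root
(`DisjointProgram.sum_powerset_prod_weight`). Each weight depends on at most four Boolean variables,
or on one Boolean variable and one indeterminate.

Finally, such weights are written as Boolean sums of products of binary forms. In characteristic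
different from `2` the constraint `z → (y = c)` is a product of two affine forms in `y` and `z`
(`SumProdRep.implication`). A new Boolean variable `z` with weight `1 + (c - 2) z` and with
constraints that force a given assignment if `z = 1` contributes the factor `c` at this assignment
and `1` at all others (`SumProdRep.weight_of_agree`), and a function of four Boolean variables is a
product of sixteen such factors. -/

namespace AlgComplexity

/-! ### Multiplicatively disjoint programs as signed Bayesian networks -/

/-- A straight-line program with instructions indexed by `ι`, in which `u` computes
`∑ c * ∏ v ∈ M, (value of v)` over the monomials `(c, M)` of `rule u`. Every instruction owns a
finite set `support u`, and the factors of a monomial of `u` own nonempty, pairwise disjoint subsets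
of `support u`: the program is multiplicatively disjoint, so that no instruction is ever multiplied
by itself. `rank` witnesses that the program is acyclic. -/
structure DisjointProgram (ι A : Type*) where
  rank : ι → ℕ
  rule : ι → List (A × Finset ι)
  support : ι → Finset ℕ
  rank_lt : ∀ u, ∀ p ∈ rule u, ∀ v ∈ p.2, rank v < rank u
  support_subset : ∀ u, ∀ p ∈ rule u, ∀ v ∈ p.2, support v ⊆ support u
  support_nonempty : ∀ u, ∀ p ∈ rule u, ∀ v ∈ p.2, (support v).Nonempty
  pairwiseDisjoint : ∀ u, ∀ p ∈ rule u, (p.2 : Set ι).PairwiseDisjoint support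

namespace DisjointProgram

variable {ι A : Type*} [DecidableEq ι] [CommRing A] (D : DisjointProgram ι A)

/-- The rule of `u`, evaluated at the indicator function of `B`. -/
def ruleAt (u : ι) (B : Finset ι) : A :=
  ((D.rule u).map fun p => if p.2 ⊆ B then p.1 else 0).sum

/-- The signed conditional probability of the event that `u` has the state recorded in `B`: the
state `u ∈ B` has probability `D.ruleAt u B`. -/
def weight (u : ι) (B : Finset ι) : A :=
  if u ∈ B then D.ruleAt u B else 1 - D.ruleAt u B

/-- `V` satisfies the defining equations of the program at all instructions with nonempty
support. -/
def IsValue (V : ι → A) : Prop :=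
  ∀ u, (D.support u).Nonempty → V u = ((D.rule u).map fun p => p.1 * ∏ v ∈ p.2, V v).sum

omit [DecidableEq ι] [CommRing A] in
lemma notMem_of_rank_le {u a : ι} (h : D.rank u ≤ D.rank a) {p : A × Finset ι}
    (hp : p ∈ D.rule u) : a ∉ p.2 := fun ha =>
  absurd (D.rank_lt u p hp a ha) (not_lt.2 h)

lemma ruleAt_insert {u a : ι} (h : D.rank u ≤ D.rank a) (B : Finset ι) :
    D.ruleAt u (insert a B) = D.ruleAt u B := by
  unfold ruleAt
  congr 1
  refine List.map_congr_left fun p hp => ?_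
  simp only [Finset.subset_insert_iff_of_notMem (D.notMem_of_rank_le h hp)]

/-- The expectation of a product of indicators is linear in the rule by which one of the factors
has been replaced. -/
lemma sum_ite_subset_mul (T S : Finset ι) (W V : Finset ι → A) (c : A) (l : List (A × Finset ι))
    (h : ∀ p ∈ l, (∑ B ∈ T.powerset, if S ∪ p.2 ⊆ B then W B else 0) = c * V p.2) :
    (∑ B ∈ T.powerset, if S ⊆ B then (l.map fun p => if p.2 ⊆ B then p.1 else 0).sum * W B else 0)
      = c * (l.map fun p => p.1 * V p.2).sum := by
  induction l with
  | nil => simp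
  | cons p l ih =>
    have h1 := h p (by simp)
    have h2 := ih fun p hp => h p (by simp [hp])
    simp only [List.map_cons, List.sum_cons]
    rw [mul_add, ← h2, mul_left_comm, ← h1, Finset.mul_sum, ← Finset.sum_add_distrib]
    refine Finset.sum_congr rfl fun B _ => ?_
    simp only [Finset.union_subset_iff]
    by_cases hS : S ⊆ B <;> by_cases hp : p.2 ⊆ B <;> simp [hS, hp, add_mul]

/-- In the signed Bayesian network of the program, the indicators of instructions with disjoint
supports are uncorrelated, and the expectation of an indicator is the value of the instruction.
By induction on `T`: an instruction of maximal rank is either summed out, as its two weights add up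
to `1`, or its indicator is replaced by its rule, whose monomials have supports disjoint from those
of the remaining factors. -/
theorem sum_powerset_prod_weight {V : ι → A} (hV : D.IsValue V) (T : Finset ι) :
    (∀ u ∈ T, ∀ p ∈ D.rule u, p.2 ⊆ T) → ∀ S ⊆ T, (∀ v ∈ S, (D.support v).Nonempty) →
      (S : Set ι).PairwiseDisjoint D.support →
      (∑ B ∈ T.powerset, if S ⊆ B then ∏ u ∈ T, D.weight u B else 0) = ∏ v ∈ S, V v := by
  induction T using Finset.induction_on_max_value D.rank with
  | empty =>
    intro _ S hS _ _
    obtain rfl := Finset.subset_empty.1 hS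
    simp
  | insert a T haT hmax ih =>
    intro hcl S hS hne hdisj
    have hclT : ∀ u ∈ T, ∀ p ∈ D.rule u, p.2 ⊆ T := by
      intro u hu p hp v hv
      refine (Finset.mem_insert.1 (hcl u (by simp [hu]) p hp hv)).resolve_left ?_
      rintro rfl
      exact D.notMem_of_rank_le (hmax u hu) hp hv
    have hcla : ∀ p ∈ D.rule a, p.2 ⊆ T := by
      intro p hp v hv
      refine (Finset.mem_insert.1 (hcl a (by simp) p hp hv)).resolve_left ?_
      rintro rfl
      exact D.notMem_of_rank_le le_rfl hp hv
    specialize ih hclT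
    rw [Finset.sum_powerset_insert haT, ← Finset.sum_add_distrib]
    have key : ∀ B ∈ T.powerset,
        ((if S ⊆ B then ∏ u ∈ insert a T, D.weight u B else 0) +
          if S ⊆ insert a B then ∏ u ∈ insert a T, D.weight u (insert a B) else 0) =
        (if S ⊆ B then (1 - D.ruleAt a B) * ∏ u ∈ T, D.weight u B else 0) +
          if S ⊆ insert a B then D.ruleAt a B * ∏ u ∈ T, D.weight u B else 0 := by
      intro B hB
      have haB : a ∉ B := fun h => haT (Finset.mem_powerset.1 hB h)
      have h1 : D.weight a B = 1 - D.ruleAt a B := by simp [weight, haB]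
      have h2 : D.weight a (insert a B) = D.ruleAt a B := by
        simp [weight, D.ruleAt_insert le_rfl]
      have h3 : ∏ u ∈ T, D.weight u (insert a B) = ∏ u ∈ T, D.weight u B := by
        refine Finset.prod_congr rfl fun u hu => ?_
        have hua : u ≠ a := fun h => haT (h ▸ hu)
        simp [weight, D.ruleAt_insert (hmax u hu), hua]
      rw [Finset.prod_insert haT, Finset.prod_insert haT, h1, h2, h3]
    rw [Finset.sum_congr rfl key]
    by_cases haS : a ∈ S
    · have hS' : S.erase a ⊆ T := by
        intro v hv
        exact (Finset.mem_insert.1 (hS (Finset.mem_of_mem_erase hv))).resolve_left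
          (Finset.ne_of_mem_erase hv)
      rw [← Finset.prod_erase_mul _ _ haS, hV a (hne a haS)]
      rw [← sum_ite_subset_mul T (S.erase a) (fun B => ∏ u ∈ T, D.weight u B)
        (fun M => ∏ v ∈ M, V v)]
      · refine Finset.sum_congr rfl fun B hB => ?_
        have haB : ¬ S ⊆ B := fun h => haT (Finset.mem_powerset.1 hB (h haS))
        rw [if_neg haB, zero_add]
        simp only [Finset.subset_insert_iff, ruleAt]
      · intro p hp
        have hvw : ∀ v ∈ S.erase a, ∀ w ∈ p.2, Disjoint (D.support v) (D.support w) := by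
          intro v hv w hw
          refine Disjoint.mono_right (D.support_subset a p hp w hw) ?_
          exact hdisj (by simpa using Finset.mem_of_mem_erase hv) (by simpa using haS)
            (Finset.ne_of_mem_erase hv)
        have hdis : Disjoint (S.erase a) p.2 := by
          rw [Finset.disjoint_left]
          intro v hv hw
          have := hvw v hv v hw
          rw [disjoint_self] at this
          exact (D.support_nonempty a p hp v hw).ne_empty this
        rw [← Finset.prod_union hdis]
        refine ih _ (Finset.union_subset hS' (hcla p hp)) ?_ ?_
        · intro v hv
          rcases Finset.mem_union.1 hv with hv | hv
          · exact hne v (Finset.mem_of_mem_erase hv)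
          · exact D.support_nonempty a p hp v hv
        · rw [Finset.coe_union, Set.pairwiseDisjoint_union]
          exact ⟨hdisj.subset (by simp), D.pairwiseDisjoint a p hp,
            fun v hv w hw _ => hvw v (Finset.mem_coe.1 hv) w (Finset.mem_coe.1 hw)⟩
    · have hS' : S ⊆ T := (Finset.subset_insert_iff_of_notMem haS).1 hS
      rw [← ih S hS' hne hdisj]
      refine Finset.sum_congr rfl fun B _ => ?_
      simp only [Finset.subset_insert_iff_of_notMem haS]
      split_ifs <;> ring

end DisjointProgram

/-! ### Boolean sums of products of binary affine forms -/

/-- The affine form `α u + β v + γ` in the variables `u` and `v`. -/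
structure BinaryForm (F W : Type*) where
  α : F
  β : F
  γ : F
  u : W
  v : W

namespace BinaryForm

variable {F W W' : Type*} [Field F]

/-- The value of an affine form under a polynomial assignment of its variables. -/
noncomputable def eval (ℓ : BinaryForm F W) (ρ : W → MvPolynomial ℕ F) : MvPolynomial ℕ F :=
  MvPolynomial.C ℓ.α * ρ ℓ.u + MvPolynomial.C ℓ.β * ρ ℓ.v + MvPolynomial.C ℓ.γ

/-- Renaming of variables. -/
def map (f : W → W') (ℓ : BinaryForm F W) : BinaryForm F W' :=
  ⟨ℓ.α, ℓ.β, ℓ.γ, f ℓ.u, f ℓ.v⟩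

lemma eval_map (f : W → W') (ℓ : BinaryForm F W) (ρ : W' → MvPolynomial ℕ F) :
    (ℓ.map f).eval ρ = ℓ.eval (ρ ∘ f) := rfl

end BinaryForm

open MvPolynomial

variable {F : Type*} [Field F] {ι : Type*}

/-- A truth value as a polynomial. -/
noncomputable def bit (F : Type*) [Field F] (b : Bool) : MvPolynomial ℕ F := if b then 1 else 0

/-- The assignment of polynomials to variables of three kinds: auxiliary Boolean variables, named
Boolean variables, and the indeterminates `x₀, x₁, …`, which stand for themselves. -/
noncomputable def assign (F : Type*) [Field F] {k : ℕ} {ι : Type*} (b : Fin k → Bool)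
    (y : ι → Bool) : Fin k ⊕ ι ⊕ ℕ → MvPolynomial ℕ F :=
  Sum.elim (fun i => bit F (b i)) (Sum.elim (fun u => bit F (y u)) X)

/-- The function `φ` of a Boolean assignment `y` is a sum, over the values of at most `s` auxiliary
Boolean variables, of a product of at most `s` affine forms in at most two variables each. -/
def SumProdRep (s : ℕ) (φ : (ι → Bool) → MvPolynomial ℕ F) : Prop :=
  ∃ k ≤ s, ∃ L : List (BinaryForm F (Fin k ⊕ ι ⊕ ℕ)), L.length ≤ s ∧
    ∀ y, φ y = ∑ b : Fin k → Bool, (L.map fun ℓ => ℓ.eval (assign F b y)).prod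

lemma sum_bool_append {M : Type*} [AddCommMonoid M] (k l : ℕ) (f : (Fin (k + l) → Bool) → M) :
    ∑ b, f b = ∑ b : Fin k → Bool, ∑ c : Fin l → Bool, f (Fin.append b c) := by
  rw [← Fintype.sum_prod_type']
  exact (Fintype.sum_equiv (Fin.appendEquiv k l) _ _ fun _ => rfl).symm

namespace SumProdRep

lemma mono {s t : ℕ} (h : s ≤ t) {φ : (ι → Bool) → MvPolynomial ℕ F} (hφ : SumProdRep s φ) :
    SumProdRep t φ := by
  obtain ⟨k, hk, L, hL, e⟩ := hφ
  exact ⟨k, hk.trans h, L, hL.trans h, e⟩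

lemma congr {s : ℕ} {φ ψ : (ι → Bool) → MvPolynomial ℕ F} (hφ : SumProdRep s φ)
    (h : ∀ y, ψ y = φ y) : SumProdRep s ψ := by
  rwa [show ψ = φ from funext h]

lemma one : SumProdRep 0 fun _ : ι → Bool => (1 : MvPolynomial ℕ F) :=
  ⟨0, le_rfl, [], by simp, fun y => by simp⟩

lemma form (ℓ : BinaryForm F (ι ⊕ ℕ)) :
    SumProdRep 1 fun y => ℓ.eval (Sum.elim (fun u => bit F (y u)) X) :=
  ⟨0, by simp, [ℓ.map Sum.inr], by simp, fun y => by
    simp [BinaryForm.eval_map]; rfl⟩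

lemma mul {s t : ℕ} {φ ψ : (ι → Bool) → MvPolynomial ℕ F} (hφ : SumProdRep s φ)
    (hψ : SumProdRep t ψ) : SumProdRep (s + t) fun y => φ y * ψ y := by
  obtain ⟨k, hk, L, hL, e⟩ := hφ
  obtain ⟨k', hk', L', hL', e'⟩ := hψ
  refine ⟨k + k', by omega, L.map (BinaryForm.map (Sum.map (Fin.castAdd k') id)) ++
    L'.map (BinaryForm.map (Sum.map (Fin.natAdd k) id)), by simp; omega, fun y => ?_⟩
  simp only [sum_bool_append, e, e', Finset.sum_mul_sum]
  refine Finset.sum_congr rfl fun b _ => Finset.sum_congr rfl fun c _ => ?_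
  simp only [List.map_append, List.map_map, List.prod_append]
  congr 3
  · funext ℓ
    simp only [Function.comp, BinaryForm.eval_map]
    congr 1
    funext w
    rcases w with i | w <;> simp [assign]
  · funext ℓ
    simp only [Function.comp, BinaryForm.eval_map]
    congr 1
    funext w
    rcases w with i | w <;> simp [assign]

lemma prod {κ : Type*} (T : Finset κ) {s : ℕ} {φ : κ → (ι → Bool) → MvPolynomial ℕ F}
    (h : ∀ u ∈ T, SumProdRep s (φ u)) : SumProdRep (T.card * s) fun y => ∏ u ∈ T, φ u y := by
  classical
  induction T using Finset.induction_on with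
  | empty => simpa using one
  | insert a T ha ih =>
    have := (h a (by simp)).mul (ih fun u hu => h u (by simp [hu]))
    simp only [Finset.prod_insert ha, Finset.card_insert_of_notMem ha]
    exact this.mono (by rw [add_mul]; omega)

/-- Summation over a Boolean variable. -/
lemma sum_option {s : ℕ} {φ : (Option ι → Bool) → MvPolynomial ℕ F} (hφ : SumProdRep s φ) :
    SumProdRep (s + 1) fun y : ι → Bool => ∑ z : Bool, φ fun o => o.elim z y := by
  obtain ⟨k, hk, L, hL, e⟩ := hφ
  let f : Fin k ⊕ Option ι ⊕ ℕ → Fin (k + 1) ⊕ ι ⊕ ℕ :=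
    Sum.elim (fun i => Sum.inl (Fin.castAdd 1 i)) (Sum.elim
      (fun o => o.elim (Sum.inl (Fin.natAdd k 0)) fun u => Sum.inr (Sum.inl u))
      fun x => Sum.inr (Sum.inr x))
  refine ⟨k + 1, by omega, L.map (BinaryForm.map f), by simp; omega, fun y => ?_⟩
  rw [sum_bool_append, Finset.sum_comm, ← (Equiv.funUnique (Fin 1) Bool).symm.sum_comp]
  refine Finset.sum_congr rfl fun z _ => ?_
  rw [e]
  refine Finset.sum_congr rfl fun b _ => ?_
  simp only [List.map_map]
  congr 2
  funext ℓ
  simp only [Function.comp, BinaryForm.eval_map]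
  congr 1
  funext w
  rcases w with i | o | x
  · simp [assign, f]
  · cases o <;> simp [assign, f]
  · simp [assign, f]

/-- The constraint `z → (y u = c)` between two Boolean variables is a product of two affine forms:
with `t = 2 - z - y u` for `c = 0` and `t = 1 - z + y u` for `c = 1`, it is `t (3 - t) / 2`, which
takes the values `0, 1, 1` at `t = 0, 1, 2`. This is where the characteristic must not be `2`. -/
lemma implication (h2 : (2 : F) ≠ 0) (z u : ι) (c : Bool) :
    SumProdRep 2 fun y : ι → Bool => bit F (!y z || (y u == c)) := by
  have two : C (2 : F) = (2 : MvPolynomial ℕ F) := map_ofNat C 2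
  have half : C (2⁻¹ : F) * (2 : MvPolynomial ℕ F) = 1 := by
    rw [← two, ← C_mul, inv_mul_cancel₀ h2, C_1]
  cases c
  · have := (form (⟨-1, -1, 2, Sum.inl z, Sum.inl u⟩ : BinaryForm F (ι ⊕ ℕ))).mul
      (form ⟨2⁻¹, 2⁻¹, 2⁻¹, Sum.inl z, Sum.inl u⟩)
    convert this using 2 with y
    cases hz : y z <;> cases hu : y u <;>
      simp only [bit, BinaryForm.eval, hz, hu, two, C_neg, C_1, Sum.elim_inl, Bool.not_true,
        Bool.not_false, Bool.true_or, Bool.false_or, beq_iff_eq, if_true,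
        reduceCtorEq, if_false, Bool.false_eq_true]
    · linear_combination -half
    · linear_combination -half
    · linear_combination -half
    · ring
  · have := (form (⟨-1, 1, 1, Sum.inl z, Sum.inl u⟩ : BinaryForm F (ι ⊕ ℕ))).mul
      (form ⟨2⁻¹, -2⁻¹, 1, Sum.inl z, Sum.inl u⟩)
    convert this using 2 with y
    cases hz : y z <;> cases hu : y u <;>
      simp only [bit, BinaryForm.eval, hz, hu, C_neg, C_1, Sum.elim_inl, Bool.not_true,
        Bool.not_false, Bool.true_or, Bool.false_or, beq_iff_eq, if_true,
        if_false, Bool.false_eq_true]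
    · ring
    · linear_combination half
    · ring
    · ring

/-- A weight `c` that applies only if `y` agrees with the indicator function of `S` on `D`: with an
additional Boolean variable `z` that forces the agreement, it is the sum of the summands `1` (for
`z = 0`) and `c - 1` (for `z = 1`, if `y` agrees). -/
lemma weight_of_agree [DecidableEq ι] (h2 : (2 : F) ≠ 0) (D S : Finset ι) (c : F) :
    SumProdRep (D.card * 2 + 2) fun y : ι → Bool =>
      if ∀ u ∈ D, y u = decide (u ∈ S) then C c else 1 := by
  have h := sum_option ((form (⟨c - 2, 0, 1, Sum.inl none, Sum.inl none⟩ :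
    BinaryForm F (Option ι ⊕ ℕ))).mul (prod D fun u _ =>
      implication h2 none (some u) (decide (u ∈ S))))
  refine (mono (by omega) h : SumProdRep (D.card * 2 + 2) _).congr fun y => ?_
  have hp : ∏ u ∈ D, bit F (y u == decide (u ∈ S)) =
      if ∀ u ∈ D, y u = decide (u ∈ S) then 1 else 0 := by
    simp only [bit, beq_iff_eq]
    exact Finset.prod_ite_zero.trans (by simp)
  simp only [Fintype.sum_bool, BinaryForm.eval, Sum.elim_inl, Option.elim_none, Option.elim_some,
    Bool.not_true, Bool.not_false, Bool.false_or, Bool.true_or, hp]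
  have two : C (2 : F) = (2 : MvPolynomial ℕ F) := map_ofNat C 2
  split_ifs <;> simp [bit, two]
  ring

/-- Every function of a few Boolean variables is a Boolean sum of products of binary forms: it is
the product, over all assignments, of the weight of the assignment. -/
lemma of_dependsOn (h2 : (2 : F) ≠ 0) (D : Finset ι) (φ : (ι → Bool) → F)
    (hφ : ∀ y y', (∀ u ∈ D, y u = y' u) → φ y = φ y') :
    SumProdRep (2 ^ D.card * (D.card * 2 + 2)) fun y => C (φ y) := by
  classical
  have h := prod D.powerset fun S _ => weight_of_agree h2 D S (φ fun u => decide (u ∈ S))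
  rw [Finset.card_powerset] at h
  refine h.congr fun y => ?_
  rw [Finset.prod_eq_single (D.filter fun u => y u = true)]
  · have hy : ∀ u ∈ D, y u = decide (u ∈ D.filter fun u => y u = true) := by
      intro u hu
      simp [hu]
    rw [if_pos hy, hφ y _ hy]
  · intro S hS hne
    rw [if_neg]
    intro hy
    refine hne (Finset.ext fun u => ?_)
    rw [Finset.mem_filter]
    constructor
    · intro hu
      have huD := Finset.mem_powerset.1 hS hu
      exact ⟨huD, by simpa [hu] using hy u huD⟩
    · rintro ⟨huD, hu⟩
      simpa [hu] using hy u huD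
  · intro h
    exact absurd (Finset.mem_powerset.2 (Finset.filter_subset _ _)) h

end SumProdRep

/-! ### Circuits as multiplicatively disjoint programs -/

lemma homogeneousComponent_mul_eq_sum (p q : MvPolynomial ℕ F) (n : ℕ) :
    homogeneousComponent n (p * q) =
      ∑ e ∈ Finset.range (n + 1), homogeneousComponent e p * homogeneousComponent (n - e) q := by
  have expand : ∀ (r : MvPolynomial ℕ F) (m : ℕ), r.totalDegree < m →
      r = ∑ i ∈ Finset.range m, homogeneousComponent i r := by
    intro r m hm
    conv_lhs => rw [← sum_homogeneousComponent r]
    refine Finset.sum_subset (by simpa using hm) fun i _ hi => ?_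
    exact homogeneousComponent_eq_zero _ _ (by simpa using hi)
  obtain ⟨m, hpm, hqm, hnm⟩ : ∃ m, p.totalDegree < m ∧ q.totalDegree < m ∧ n < m :=
    ⟨p.totalDegree + q.totalDegree + n + 1, by omega, by omega, by omega⟩
  have h : ∀ i j, homogeneousComponent n (homogeneousComponent i p * homogeneousComponent j q) =
      if i + j = n then homogeneousComponent i p * homogeneousComponent j q else 0 := by
    intro i j
    rw [homogeneousComponent_of_mem (m := n) (n := i + j)]
    · simp [eq_comm]
    · exact (homogeneousComponent_isHomogeneous i p).mul (homogeneousComponent_isHomogeneous j q)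
  conv_lhs => rw [expand p m hpm, expand q m hqm]
  rw [Finset.sum_mul_sum, ← Finset.sum_product', map_sum]
  simp only [h]
  rw [← Finset.sum_filter, ← Finset.Nat.sum_antidiagonal_eq_sum_range_succ
    (fun i j => homogeneousComponent i p * homogeneousComponent j q)]
  refine Finset.sum_congr ?_ fun _ _ => rfl
  ext ⟨i, j⟩
  simp
  omega

namespace Circuit

variable (Γ : Circuit F) (d : ℕ)

/-- The instructions of the homogenized, multiplicatively disjoint version of a circuit, truncated
at degree `d`. The instruction `Sum.inl (i, s, a, t)` with `s ≤ a < t` is a copy, reserved for the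
interval `[s, t)`, of a partial sum of the expression for the component of degree `t - s` of gate
`i`; the partial sum is complete for `a = t - 1`. The instruction `Sum.inr a` is the sum of the
components of degree at most `a` of the output. -/
abbrev Instr : Type := (Fin Γ.size × Fin (d + 1) × Fin (d + 1) × Fin (d + 1)) ⊕ Fin (d + 1)

variable {Γ d}

/-- The truncated predecessor. -/
def prev (a : Fin (d + 1)) : Fin (d + 1) := ⟨a - 1, by omega⟩

/-- The copy for the interval `[s, t)` of the component of degree `t - s` of gate `j`. -/
def copy (j : Fin Γ.size) (s t : Fin (d + 1)) : Γ.Instr d := Sum.inl (j, s, prev t, t)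

variable (Γ d)

/-- The rules of the instructions: an indeterminate, or a linear combination of products of
instructions. The component of degree `0` of a gate is a constant and needs no instruction: in the
component of degree `t - s` of a product, the two summands with a factor of degree `0` form the
partial sum with `a = s`, and a split of `[s, t)` at an interior point `a` gives the others. -/
noncomputable def instrRule : Γ.Instr d → ℕ ⊕ List (F × Finset (Γ.Instr d))
  | Sum.inl (i, s, a, t) =>
    if s ≤ a ∧ a < t then
      match Γ.gate i with
      | .const _ => Sum.inr []
      | .var x => if (t : ℕ) = s + 1 then Sum.inl x else Sum.inr []
      | .add j k =>
        Sum.inr [(1, {copy ⟨j, j.2.trans i.2⟩ s t}), (1, {copy ⟨k, k.2.trans i.2⟩ s t})]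
      | .mul j k =>
        if a = s then
          Sum.inr
            [(coeff 0 (Γ.gateValue ⟨k, k.2.trans i.2⟩), {copy ⟨j, j.2.trans i.2⟩ s t}),
             (coeff 0 (Γ.gateValue ⟨j, j.2.trans i.2⟩), {copy ⟨k, k.2.trans i.2⟩ s t})]
        else
          Sum.inr
            [(1, {Sum.inl (i, s, prev a, t)}),
             (1, {copy ⟨j, j.2.trans i.2⟩ s a, copy ⟨k, k.2.trans i.2⟩ a t})]
    else Sum.inr []
  | Sum.inr a =>
    if a = 0 then Sum.inr [(coeff 0 Γ.value, ∅)]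
    else Sum.inr [(1, {Sum.inr (prev a)}), (1, {copy Γ.output 0 a})]

/-- A topological order of the instructions. -/
def instrRank : Γ.Instr d → ℕ
  | Sum.inl (i, _, a, _) => i * (d + 1) + a
  | Sum.inr a => Γ.size * (d + 1) + a

/-- The interval for which an instruction is reserved; it is empty for indices without meaning. -/
def instrSupport : Γ.Instr d → Finset ℕ
  | Sum.inl (_, s, a, t) => if s ≤ a ∧ a < t then Finset.Ico s t else ∅
  | Sum.inr _ => Finset.range (d + 1)

/-- The polynomials computed by the instructions. -/
noncomputable def instrValue : Γ.Instr d → MvPolynomial ℕ F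
  | Sum.inl (i, s, a, t) =>
    if s ≤ a ∧ a < t then
      match Γ.gate i with
      | .mul j k =>
        (∑ e ∈ Finset.range (a - s + 1 : ℕ),
          homogeneousComponent e (Γ.gateValue ⟨j, j.2.trans i.2⟩) *
            homogeneousComponent (t - s - e : ℕ) (Γ.gateValue ⟨k, k.2.trans i.2⟩)) +
          homogeneousComponent (t - s : ℕ) (Γ.gateValue ⟨j, j.2.trans i.2⟩) *
            homogeneousComponent 0 (Γ.gateValue ⟨k, k.2.trans i.2⟩)
      | _ => homogeneousComponent (t - s : ℕ) (Γ.gateValue i)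
    else 0
  | Sum.inr a => ∑ e ∈ Finset.range (a + 1 : ℕ), homogeneousComponent e Γ.value

variable {Γ d}

omit [Field F] in
lemma instrSupport_copy {j : Fin Γ.size} {s t : Fin (d + 1)} (h : s < t) :
    Γ.instrSupport d (copy j s t) = Finset.Ico (s : ℕ) t := by
  simp only [copy, instrSupport, prev]
  rw [if_pos]
  simp only [Fin.lt_def, Fin.le_def] at *
  omega

omit [Field F] in
lemma instrRank_copy_lt {j : Fin Γ.size} {s t : Fin (d + 1)} {n : ℕ} (h : (j : ℕ) < n) (a : ℕ) :
    Γ.instrRank d (copy j s t) < n * (d + 1) + a := by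
  have : ((j : ℕ) + 1) * (d + 1) ≤ n * (d + 1) := Nat.mul_le_mul_right _ h
  simp only [copy, instrRank, prev]
  have := t.2
  rw [add_mul] at *
  omega

lemma instrValue_copy (j : Fin Γ.size) {s t : Fin (d + 1)} (h : s < t) :
    Γ.instrValue d (copy j s t) = homogeneousComponent (t - s : ℕ) (Γ.gateValue j) := by
  have h' : s ≤ prev t ∧ prev t < t := by
    simp only [Fin.lt_def, Fin.le_def, prev] at *
    omega
  simp only [copy, instrValue, if_pos h']
  split
  · next j' k' hg =>
    have e1 : ((prev t : Fin (d + 1)) - s + 1 : ℕ) = t - s := by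
      simp only [Fin.lt_def, prev] at *
      omega
    conv_rhs => rw [gateValue]
    simp only [hg]
    rw [homogeneousComponent_mul_eq_sum, e1, Finset.sum_range_succ]
    simp
  · rfl

lemma instrRule_spec (u : Γ.Instr d) {l : List (F × Finset (Γ.Instr d))}
    (hu : Γ.instrRule d u = Sum.inr l) :
    (∀ p ∈ l, (∀ v ∈ p.2, Γ.instrRank d v < Γ.instrRank d u ∧
      Γ.instrSupport d v ⊆ Γ.instrSupport d u ∧ (Γ.instrSupport d v).Nonempty) ∧
      (p.2 : Set (Γ.Instr d)).PairwiseDisjoint (Γ.instrSupport d)) ∧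
    (l.map fun p => p.2.card).sum ≤ 3 := by
  rcases u with ⟨i, s, a, t⟩ | a
  · by_cases hv : s ≤ a ∧ a < t
    · have hst : s < t := hv.1.trans_lt hv.2
      have hst' : (s : ℕ) < t := hst
      have hsu : Γ.instrSupport d (Sum.inl (i, s, a, t)) = Finset.Ico (s : ℕ) t := by
        simp [instrSupport, hv]
      simp only [instrRule, if_pos hv] at hu
      cases hg : Γ.gate i with
      | const c =>
        simp only [hg] at hu
        cases hu; simp
      | var x =>
        simp only [hg] at hu
        split_ifs at hu
        cases hu; simp
      | add j k =>
        simp only [hg] at hu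
        cases hu
        simp [-Sum.forall, hsu, instrSupport_copy hst, hst]
        exact ⟨instrRank_copy_lt j.2 _, instrRank_copy_lt k.2 _⟩
      | mul j k =>
        simp only [hg] at hu
        split_ifs at hu with has
        · cases hu
          simp [-Sum.forall, hsu, instrSupport_copy hst, hst]
          exact ⟨instrRank_copy_lt j.2 _, instrRank_copy_lt k.2 _⟩
        · cases hu
          have hsa : s < a := lt_of_le_of_ne hv.1 (Ne.symm has)
          have hsa' : (s : ℕ) < a := hsa
          have hat' : (a : ℕ) < t := hv.2
          have hp : s ≤ prev a ∧ prev a < t := by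
            simp only [Fin.lt_def, Fin.le_def, prev] at *
            omega
          have hsp : Γ.instrSupport d (Sum.inl (i, s, prev a, t)) = Finset.Ico (s : ℕ) t := by
            simp [instrSupport, hp]
          constructor
          · intro p hp
            simp only [List.mem_cons, List.not_mem_nil, or_false] at hp
            rcases hp with rfl | rfl
            · simp [-Sum.forall, hsu, hsp, hst]
              simp only [instrRank, prev]
              omega
            · simp [-Sum.forall, hsu, instrSupport_copy hsa, instrSupport_copy hv.2, hsa, hv.2]
              refine ⟨⟨⟨instrRank_copy_lt j.2 _, Finset.Ico_subset_Ico le_rfl hat'.le⟩,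
                instrRank_copy_lt k.2 _, Finset.Ico_subset_Ico hsa'.le le_rfl⟩, ?_⟩
              rw [Set.pairwiseDisjoint_insert]
              simp [-Sum.forall, instrSupport_copy hsa, instrSupport_copy hv.2]
              intro _
              exact Finset.Ico_disjoint_Ico_consecutive _ _ _
          · simp
            have := Finset.card_le_two (a := (copy ⟨j, j.2.trans i.2⟩ s a : Γ.Instr d))
              (b := copy ⟨k, k.2.trans i.2⟩ a t)
            omega
    · simp only [instrRule, if_neg hv] at hu
      cases hu; simp
  · simp only [instrRule] at hu
    split_ifs at hu with ha
    · cases hu; simp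
    · cases hu
      have ha' : (0 : Fin (d + 1)) < a := Fin.pos_iff_ne_zero.2 ha
      have ha'' : 0 < (a : ℕ) := ha'
      simp [-Sum.forall, instrSupport_copy ha']
      refine ⟨⟨?_, ?_⟩, ?_, ?_, ha⟩
      · simp [instrRank, prev, ha'']
      · simp [instrSupport]
      · exact instrRank_copy_lt Γ.output.2 _
      · exact Finset.range_subset_range.2 a.2.le

variable (Γ d)

/-- The multiplicatively disjoint program of a circuit. -/
noncomputable def program : DisjointProgram (Γ.Instr d) (MvPolynomial ℕ F) where
  rank := Γ.instrRank d
  support := Γ.instrSupport d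
  rule u := match Γ.instrRule d u with
    | Sum.inl x => [(X x, ∅)]
    | Sum.inr l => l.map fun p => (C p.1, p.2)
  rank_lt u p hp v hv := by
    split at hp
    · simp_all
    · next l hl =>
      obtain ⟨q, hq, rfl⟩ := List.mem_map.1 hp
      exact (((instrRule_spec u hl).1 q hq).1 v hv).1
  support_subset u p hp v hv := by
    split at hp
    · simp_all
    · next l hl =>
      obtain ⟨q, hq, rfl⟩ := List.mem_map.1 hp
      exact (((instrRule_spec u hl).1 q hq).1 v hv).2.1
  support_nonempty u p hp v hv := by
    split at hp
    · simp_all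
    · next l hl =>
      obtain ⟨q, hq, rfl⟩ := List.mem_map.1 hp
      exact (((instrRule_spec u hl).1 q hq).1 v hv).2.2
  pairwiseDisjoint u p hp := by
    split at hp
    · simp_all
    · next l hl =>
      obtain ⟨q, hq, rfl⟩ := List.mem_map.1 hp
      exact ((instrRule_spec u hl).1 q hq).2

lemma isValue_instrValue : (Γ.program d).IsValue (Γ.instrValue d) := by
  rintro (⟨i, s, a, t⟩ | a) hne
  · have hv : s ≤ a ∧ a < t := by
      by_contra h
      simp [program, instrSupport, h] at hne
    have hst : s < t := hv.1.trans_lt hv.2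
    have hst' : (s : ℕ) < t := hst
    have hpos : ((t : ℕ) - s) ≠ 0 := by omega
    simp only [program, instrRule, if_pos hv]
    cases hg : Γ.gate i with
    | const c =>
      simp only [instrValue, if_pos hv, hg]
      rw [gateValue, hg]
      rw [homogeneousComponent_of_mem (m := t - s) (n := 0) (isHomogeneous_C _ c)]
      simp [hpos]
    | var x =>
      simp only [instrValue, if_pos hv, hg]
      rw [gateValue, hg]
      rw [homogeneousComponent_of_mem (m := t - s) (n := 1) (isHomogeneous_X F x)]
      have : ((t : ℕ) - s = 1) ↔ (t : ℕ) = s + 1 := by omega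
      split_ifs <;> simp_all
    | add j k =>
      simp [instrValue_copy _ hst]
      simp only [instrValue, if_pos hv, hg]
      rw [gateValue, hg, map_add]
    | mul j k =>
      by_cases has : a = s
      · simp [has, instrValue_copy _ hst]
        simp only [instrValue, hg]
        simp [homogeneousComponent_zero, hst]
        ring
      · have hsa : s < a := lt_of_le_of_ne hv.1 (Ne.symm has)
        have hsa' : (s : ℕ) < a := hsa
        have hat' : (a : ℕ) < t := hv.2
        have hp : s ≤ prev a ∧ prev a < t := by
          simp only [Fin.lt_def, Fin.le_def, prev] at *
          omega
        have hne : (copy ⟨j, j.2.trans i.2⟩ s a : Γ.Instr d) ≠ copy ⟨k, k.2.trans i.2⟩ a t := by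
          intro h
          simp [copy] at h
          omega
        simp only [if_neg has, List.map_cons, List.map_nil, List.sum_cons, List.sum_nil,
          Finset.prod_singleton, Finset.prod_pair hne, instrValue_copy _ hsa,
          instrValue_copy _ hv.2]
        simp only [instrValue, if_pos hv, if_pos hp, hg]
        have e1 : (a : ℕ) - s + 1 = ((prev a : Fin (d + 1)) : ℕ) - s + 1 + 1 := by
          simp only [prev]
          omega
        have e2 : ((prev a : Fin (d + 1)) : ℕ) - s + 1 = a - s := by
          simp only [prev]
          omega
        have e3 : (t : ℕ) - s - (a - s) = t - a := by omega
        rw [e1, Finset.sum_range_succ, e2, e3]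
        simp
        ring
  · by_cases ha : a = 0
    · simp [program, instrRule, ha, instrValue]
    · have ha' : (0 : Fin (d + 1)) < a := Fin.pos_iff_ne_zero.2 ha
      have ha'' : 0 < (a : ℕ) := ha'
      simp [program, instrRule, ha, instrValue_copy _ ha']
      have e : (a : ℕ) + 1 = ((prev a : Fin (d + 1)) : ℕ) + 1 + 1 := by
        simp only [prev]
        omega
      have e2 : ((prev a : Fin (d + 1)) : ℕ) + 1 = a := by
        simp only [prev]
        omega
      simp only [instrValue]
      rw [e, Finset.sum_range_succ, e2]
      rfl

/-- The states of the Bayesian network are weighted by products of few binary forms. -/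
lemma sumProdRep_weight (h2 : (2 : F) ≠ 0) (u : Γ.Instr d) :
    SumProdRep 160 fun y : Γ.Instr d → Bool =>
      (Γ.program d).weight u (Finset.univ.filter fun v => y v = true) := by
  cases hu : Γ.instrRule d u with
  | inl x =>
    have h := (SumProdRep.form (⟨1, 1, -1, Sum.inl u, Sum.inr x⟩ :
      BinaryForm F (Γ.Instr d ⊕ ℕ))).mul (SumProdRep.form ⟨2, 0, -1, Sum.inl u, Sum.inl u⟩)
    refine (h.mono (by norm_num)).congr fun y => ?_
    have two : C (2 : F) = (2 : MvPolynomial ℕ F) := map_ofNat C 2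
    cases hy : y u <;>
      simp [DisjointProgram.weight, DisjointProgram.ruleAt, program, hu, hy, BinaryForm.eval, bit,
        two]
    · ring
    · ring
  | inr l =>
    let D : Finset (Γ.Instr d) := insert u (l.foldr (fun p E => p.2 ∪ E) ∅)
    have hcard : ∀ l : List (F × Finset (Γ.Instr d)),
        (l.foldr (fun (p : F × Finset (Γ.Instr d)) E => p.2 ∪ E) ∅).card ≤ (l.map fun p => p.2.card).sum := by
      intro l
      induction l with
      | nil => simp
      | cons p l ih =>
        simp only [List.foldr_cons, List.map_cons, List.sum_cons]
        exact (Finset.card_union_le _ _).trans (by omega)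
    have hsub : ∀ l : List (F × Finset (Γ.Instr d)), ∀ p ∈ l,
        p.2 ⊆ l.foldr (fun (p : F × Finset (Γ.Instr d)) E => p.2 ∪ E) ∅ := by
      intro l
      induction l with
      | nil => simp
      | cons q l ih =>
        intro p hp
        rcases List.mem_cons.1 hp with rfl | hp
        · exact Finset.subset_union_left
        · exact (ih p hp).trans Finset.subset_union_right
    have hD : D.card ≤ 4 := (Finset.card_insert_le _ _).trans
      (by have := (instrRule_spec u hu).2; have := hcard l; omega)
    let r : (Γ.Instr d → Bool) → F := fun y =>
      (l.map fun p => if p.2 ⊆ Finset.univ.filter fun v => y v = true then p.1 else 0).sum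
    have h := SumProdRep.of_dependsOn h2 D (fun y => if y u then r y else 1 - r y) (by
      intro y y' hyy
      have hr : r y = r y' := by
        simp only [r]
        congr 1
        refine List.map_congr_left fun p hp => ?_
        have : (p.2 ⊆ Finset.univ.filter fun v => y v = true) ↔
            p.2 ⊆ Finset.univ.filter fun v => y' v = true := by
          simp only [Finset.subset_iff, Finset.mem_filter, Finset.mem_univ, true_and]
          refine forall₂_congr fun v hv => ?_
          rw [hyy v (Finset.mem_insert_of_mem (hsub l p hp hv))]
        simp only [this]
      simp only [hr, hyy u (Finset.mem_insert_self _ _)])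
    refine (h.mono ?_).congr fun y => ?_
    · calc 2 ^ D.card * (D.card * 2 + 2) ≤ 2 ^ 4 * (4 * 2 + 2) := by gcongr; norm_num
        _ = 160 := by norm_num
    · have hr : (Γ.program d).ruleAt u (Finset.univ.filter fun v => y v = true) = C (r y) := by
        simp only [DisjointProgram.ruleAt, program, hu, r, List.map_map]
        rw [map_list_sum, List.map_map]
        congr 1
        refine List.map_congr_left fun p _ => ?_
        simp only [Function.comp]
        split_ifs <;> simp
      simp only [DisjointProgram.weight, hr]
      by_cases hy : y u = true <;> simp [hy]

/-- A polynomial of degree at most `d` with a small circuit is the sum, over all Boolean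
assignments to the instructions, of a short Boolean sum of products of binary forms. -/
theorem exists_sumProdRep (h2 : (2 : F) ≠ 0) (hd : Γ.value.totalDegree ≤ d) :
    ∃ φ : (Γ.Instr d → Bool) → MvPolynomial ℕ F,
      SumProdRep (Fintype.card (Γ.Instr d) * 160 + 1) φ ∧ Γ.value = ∑ y, φ y := by
  let root : Γ.Instr d := Sum.inr (Fin.last d)
  refine ⟨fun y => (∏ u, (Γ.program d).weight u (Finset.univ.filter fun v => y v = true)) *
    (⟨1, 0, 0, Sum.inl root, Sum.inl root⟩ : BinaryForm F (Γ.Instr d ⊕ ℕ)).eval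
      (Sum.elim (fun u => bit F (y u)) X), ?_, ?_⟩
  · exact (SumProdRep.prod Finset.univ fun u _ => Γ.sumProdRep_weight d h2 u).mul
      (SumProdRep.form _)
  · have h := (Γ.program d).sum_powerset_prod_weight (Γ.isValue_instrValue d) Finset.univ
      (fun _ _ _ _ => Finset.subset_univ _) {root} (Finset.subset_univ _)
      (by simp [program, instrSupport, root]) (by simp)
    have hroot : Γ.instrValue d root = Γ.value := by
      conv_rhs => rw [← sum_homogeneousComponent Γ.value]
      simp only [root, instrValue, Fin.val_last]
      refine (Finset.sum_subset (by simpa using hd) fun i _ hi => ?_).symm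
      exact homogeneousComponent_eq_zero _ _ (by simpa using hi)
    rw [Finset.prod_singleton, hroot] at h
    rw [← h]
    refine Finset.sum_nbij' (fun B u => decide (u ∈ B))
      (fun y => Finset.univ.filter fun v => y v = true) ?_ ?_ ?_ ?_ ?_
    · simp
    · simp
    · intro B _
      simp
    · intro y _
      simp
    · intro B _
      by_cases hB : root ∈ B <;> simp [hB, BinaryForm.eval, bit]

end Circuit

/-! ### Hypercube sums and polynomial bounds -/

/-- Two successive hypercube sums are one: the hypercube variables of the inner sum come first. -/
lemma hypercubeSum_hypercubeSum (p k : ℕ) (g : MvPolynomial ℕ F) :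
    hypercubeSum p (hypercubeSum k g) = hypercubeSum (k + p) g := by
  simp only [hypercubeSum, sum_bool_append, map_sum]
  rw [Finset.sum_comm]
  refine Finset.sum_congr rfl fun c _ => Finset.sum_congr rfl fun b _ => ?_
  rw [bind₁_bind₁]
  congr 2
  funext i
  by_cases h1 : i < k
  · have e : (⟨i, by omega⟩ : Fin (k + p)) = Fin.castAdd p ⟨i, h1⟩ := rfl
    have h2 : i < k + p := by omega
    simp only [h1, h2, dif_pos, e, Fin.append_left]
    split_ifs <;> simp
  · simp only [h1, dif_neg, not_false_eq_true, bind₁_X_right]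
    by_cases h2 : i < k + p
    · have h3 : i - k < p := by omega
      have e : (⟨i, h2⟩ : Fin (k + p)) = Fin.natAdd k ⟨i - k, h3⟩ := by
        ext
        simp
        omega
      simp only [h2, h3, dif_pos, e, Fin.append_right]
    · have h3 : ¬ i - k < p := by omega
      simp only [h2, h3, dif_neg, not_false_eq_true]
      congr 1
      omega

/-- Summing out the named Boolean variables turns a Boolean sum of products into a hypercube
sum. -/
lemma SumProdRep.exists_hypercubeSum {ι : Type*} [Fintype ι] [DecidableEq ι] {s : ℕ}
    {φ : (ι → Bool) → MvPolynomial ℕ F} (hφ : SumProdRep s φ) :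
    ∃ k ≤ s + Fintype.card ι, ∃ m ≤ s, ∃ ℓ : Fin m → MvPolynomial ℕ F,
      (∀ i, ℓ i ∈ weakPlusForms F) ∧ ∑ y, φ y = hypercubeSum k (∏ i, ℓ i) := by
  obtain ⟨k, hk, L, hL, e⟩ := hφ
  let f : Fin k ⊕ ι ⊕ ℕ → ℕ := Sum.elim (fun i => i) (Sum.elim
    (fun u => k + Fintype.equivFin ι u) fun x => k + Fintype.card ι + x)
  refine ⟨k + Fintype.card ι, by omega, L.length, hL, fun i => (L.get i).eval (X ∘ f),
    fun i => ⟨_, _, _, _, _, rfl⟩, ?_⟩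
  have hprod : ∏ i, (L.get i).eval (X ∘ f) = (L.map fun ℓ => ℓ.eval (X ∘ f)).prod := by
    rw [← List.prod_ofFn]
    congr 1
    exact List.ofFn_getElem_eq_map L fun ℓ => ℓ.eval (X ∘ f)
  rw [hprod]
  simp only [hypercubeSum, sum_bool_append, e]
  rw [Finset.sum_comm]
  refine Finset.sum_congr rfl fun b _ => ?_
  refine Fintype.sum_equiv ((Fintype.equivFin ι).arrowCongr (Equiv.refl Bool)) _ _ fun y => ?_
  rw [map_list_prod, List.map_map]
  congr 1
  refine List.map_congr_left fun ℓ _ => ?_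
  have hv : ∀ w, assign F b y w = bind₁ (fun i => if h : i < k + Fintype.card ι then
      (if Fin.append b ((Fintype.equivFin ι).arrowCongr (Equiv.refl Bool) y) ⟨i, h⟩ then 1 else 0)
      else X (i - (k + Fintype.card ι))) (X (f w) : MvPolynomial ℕ F) := by
    intro w
    rw [bind₁_X_right]
    rcases w with i | u | x
    · have h : (i : ℕ) < k + Fintype.card ι := by omega
      have e : (⟨i, h⟩ : Fin (k + Fintype.card ι)) = Fin.castAdd _ i := rfl
      simp [f, assign, bit, h, e]
    · have h : k + (Fintype.equivFin ι u : ℕ) < k + Fintype.card ι := by omega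
      have e : (⟨k + Fintype.equivFin ι u, h⟩ : Fin (k + Fintype.card ι)) =
        Fin.natAdd k (Fintype.equivFin ι u) := rfl
      simp [f, assign, bit, e]
    · simp [f, assign]
  simp only [BinaryForm.eval, Function.comp, hv, map_add, map_mul, bind₁_C_right]

namespace PolyBounded

lemma of_le {s t : ℕ → ℕ} (ht : PolyBounded t) (h : ∀ n, s n ≤ t n) : PolyBounded s := by
  obtain ⟨P, hP⟩ := ht
  exact ⟨P, fun n => (h n).trans (hP n)⟩

lemma const (c : ℕ) : PolyBounded fun _ => c :=
  ⟨Polynomial.C c, by simp⟩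

lemma id : PolyBounded fun n => n :=
  ⟨Polynomial.X, by simp⟩

lemma add {s t : ℕ → ℕ} (hs : PolyBounded s) (ht : PolyBounded t) :
    PolyBounded fun n => s n + t n := by
  obtain ⟨P, hP⟩ := hs
  obtain ⟨Q, hQ⟩ := ht
  exact ⟨P + Q, fun n => by simpa using Nat.add_le_add (hP n) (hQ n)⟩

lemma mul {s t : ℕ → ℕ} (hs : PolyBounded s) (ht : PolyBounded t) :
    PolyBounded fun n => s n * t n := by
  obtain ⟨P, hP⟩ := hs
  obtain ⟨Q, hQ⟩ := ht
  exact ⟨P * Q, fun n => by simpa using Nat.mul_le_mul (hP n) (hQ n)⟩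

lemma comp {s t : ℕ → ℕ} (hs : PolyBounded s) (ht : PolyBounded t) :
    PolyBounded fun n => s (t n) := by
  obtain ⟨P, hP⟩ := hs
  obtain ⟨Q, hQ⟩ := ht
  refine ⟨P.comp Q, fun n => (hP _).trans ?_⟩
  rw [Polynomial.eval_comp, Polynomial.eval_eq_sum_range, Polynomial.eval_eq_sum_range]
  gcongr
  exact hQ n

end PolyBounded

/-- The families of hypercube sums of polynomially many variables over products of polynomially many
affine forms in at most two variables each. -/
def SumProdFamilies (F : Type*) [Field F] : Set (Family F) :=
  {f | ∃ (p m : ℕ → ℕ) (ℓ : (n : ℕ) → Fin (m n) → MvPolynomial ℕ F),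
    PolyBounded p ∧ PolyBounded m ∧ (∀ n i, ℓ n i ∈ weakPlusForms F) ∧
      ∀ n, f n = hypercubeSum (p n) (∏ i, ℓ n i)}

theorem VNP_subset_sumProdFamilies (h2 : (2 : F) ≠ 0) : VNP F ⊆ SumProdFamilies F := by
  rintro f ⟨g, ⟨-, hdeg, Γ, hsize, hΓ⟩, p, q, hp, hq, hf⟩
  let c : ℕ → ℕ := fun n => Fintype.card ((Γ n).Instr (g n).totalDegree)
  have hc : PolyBounded c := by
    have hd := hdeg.add (PolyBounded.const 1)
    refine ((hsize.mul (hd.mul (hd.mul hd))).add hd).of_le fun n => ?_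
    simp [c]
  have key : ∀ n, ∃ k ≤ c n * 161 + 1, ∃ m ≤ c n * 161 + 1, ∃ ℓ : Fin m → MvPolynomial ℕ F,
      (∀ i, ℓ i ∈ weakPlusForms F) ∧ g n = hypercubeSum k (∏ i, ℓ i) := by
    intro n
    obtain ⟨φ, hφ, e⟩ := (Γ n).exists_sumProdRep (g n).totalDegree h2 (by rw [hΓ])
    obtain ⟨k, hk, m, hm, ℓ, hℓ, h⟩ := hφ.exists_hypercubeSum
    refine ⟨k, hk.trans ?_, m, hm.trans ?_, ℓ, hℓ, by rw [← h, ← e, hΓ]⟩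
    · simp only [c]
      omega
    · simp only [c]
      omega
  choose k hk m hm ℓ hℓ h using key
  have hb : PolyBounded fun n => c n * 161 + 1 :=
    (hc.mul (PolyBounded.const 161)).add (PolyBounded.const 1)
  refine ⟨fun n => k (q n) + p n, fun n => m (q n), fun n => ℓ (q n),
    ((hb.of_le hk).comp hq).add hp, (hb.of_le hm).comp hq, fun n => hℓ (q n), fun n => ?_⟩
  rw [hf, h, hypercubeSum_hypercubeSum]

/-! ### Branching programs of width one -/

namespace ABP

lemma eq_of_layer_eq {Γ : ABP F} (h : Γ.width ≤ 1) {u v : Fin Γ.size}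
    (huv : Γ.layer u = Γ.layer v) : u = v := by
  have hc : (Finset.univ.filter fun u => Γ.layer u = Γ.layer v).card ≤ 1 :=
    (Finset.le_sup (f := fun v => (Finset.univ.filter fun u => Γ.layer u = Γ.layer v).card)
      (Finset.mem_univ v)).trans h
  exact Finset.card_le_one.1 hc u (by simpa using huv) v (by simp)

lemma IsPath.layer {Γ : ABP F} {π : Fin (Γ.pathLength + 1) → Fin Γ.size} (hπ : Γ.IsPath π)
    (i : Fin (Γ.pathLength + 1)) : Γ.layer (π i) = Γ.layer Γ.source + (i : ℕ) := by
  induction i using Fin.induction with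
  | zero => simp [hπ.1]
  | succ i ih =>
    rw [Γ.layer_of_adj _ _ (hπ.2.2 i), ih]
    simp
    ring

/-- A branching program of width one has at most one path, so that it computes a product of
labels. -/
lemma exists_list_of_width_le_one {Γ : ABP F} (h : Γ.width ≤ 1) {L : Set (MvPolynomial ℕ F)}
    (hL : Γ.LabelsIn L) (h0 : 0 ∈ L) :
    ∃ l : List (MvPolynomial ℕ F), l.length ≤ Γ.size ∧ (∀ x ∈ l, x ∈ L) ∧ Γ.value = l.prod := by
  classical
  by_cases hex : ∃ π, Γ.IsPath π
  · obtain ⟨π, hπ⟩ := hex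
    refine ⟨List.ofFn fun i : Fin Γ.pathLength => Γ.label (π i.castSucc) (π i.succ), ?_, ?_, ?_⟩
    · have hinj : Function.Injective π := by
        intro i j hij
        have := hπ.layer i
        rw [hij, hπ.layer j] at this
        ext
        omega
      have := Fintype.card_le_of_injective π hinj
      simp at this
      simp
      omega
    · simp only [List.mem_ofFn]
      rintro x ⟨i, rfl⟩
      exact hL _ _ (hπ.2.2 i)
    · rw [List.prod_ofFn, value, Finset.sum_eq_single π]
      · intro π' hπ' hne
        refine absurd (funext fun i => eq_of_layer_eq h ?_) hne
        rw [hπ.layer, IsPath.layer (by simpa using hπ')]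
      · intro hn
        simp [hπ] at hn
  · refine ⟨[0], Γ.source.pos, by simpa using h0, ?_⟩
    rw [value, Finset.sum_eq_zero]
    · simp
    · intro π hπ
      exact absurd ⟨π, by simpa using hπ⟩ hex

/-- The directed path with given edge labels. -/
noncomputable def line {m : ℕ} (ℓ : Fin m → MvPolynomial ℕ F) : ABP F where
  size := m + 1
  Adj u v := (v : ℕ) = u + 1
  label u _ := if h : (u : ℕ) < m then ℓ ⟨u, h⟩ else 0
  layer u := (u : ℕ)
  source := 0
  sink := Fin.last m
  layer_of_adj u v h := by exact_mod_cast h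
  not_adj_source u h := by simp at h
  not_sink_adj u h := by
    have := u.2
    rw [Fin.val_last] at h
    omega

lemma width_line {m : ℕ} (ℓ : Fin m → MvPolynomial ℕ F) : (line ℓ).width ≤ 1 := by
  refine Finset.sup_le fun v _ => Finset.card_le_one.2 fun a ha b hb => ?_
  have h : ((a : ℕ) : ℤ) = (b : ℕ) :=
    (Finset.mem_filter.1 ha).2.trans (Finset.mem_filter.1 hb).2.symm
  exact Fin.ext (by exact_mod_cast h)

lemma labelsIn_line {m : ℕ} {ℓ : Fin m → MvPolynomial ℕ F} {L : Set (MvPolynomial ℕ F)}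
    (h : ∀ i, ℓ i ∈ L) : (line ℓ).LabelsIn L := by
  intro u v huv
  have hu : (u : ℕ) < m := by
    have h1 : (v : ℕ) < m + 1 := v.2
    have h2 : (v : ℕ) = u + 1 := huv
    omega
  simp only [line, hu, dif_pos, h]

lemma value_line {m : ℕ} (ℓ : Fin m → MvPolynomial ℕ F) : (line ℓ).value = ∏ i, ℓ i := by
  classical
  have hlen : (line ℓ).pathLength = m := by simp [pathLength, line]
  let π : Fin ((line ℓ).pathLength + 1) → Fin (line ℓ).size := Fin.cast (by rw [hlen]; rfl)
  have hπ : (line ℓ).IsPath π := by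
    exact ⟨rfl, Fin.ext hlen, fun i => rfl⟩
  rw [value, Finset.sum_eq_single π]
  · refine Fintype.prod_equiv (finCongr hlen) _ _ fun i => ?_
    have hi : (i : ℕ) < m := i.2.trans_eq hlen
    exact dif_pos hi
  · intro π' hπ' hne
    refine absurd (funext fun i => eq_of_layer_eq (width_line ℓ) ?_) hne
    rw [hπ.layer, IsPath.layer (by simpa using hπ')]
  · intro hn
    simp [hπ] at hn

end ABP

lemma weakForms_subset_weakPlusForms : weakForms F ⊆ weakPlusForms F := by
  rintro _ ⟨α, β, i, rfl⟩
  exact ⟨α, 0, β, i, i, by simp⟩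

lemma zero_mem_weakForms : (0 : MvPolynomial ℕ F) ∈ weakForms F :=
  ⟨0, 0, 0, by simp⟩

lemma N_mono {𝒞 𝒟 : Set (Family F)} (h : 𝒞 ⊆ 𝒟) : N 𝒞 ⊆ N 𝒟 := by
  rintro f ⟨g, hg, hf⟩
  exact ⟨g, h hg, hf⟩

lemma VPwidth_mono (k : ℕ) {L L' : Set (MvPolynomial ℕ F)} (h : L ⊆ L') :
    VPwidth k L ⊆ VPwidth k L' := by
  rintro f ⟨hv, Γ, hs, hΓ⟩
  exact ⟨hv, Γ, hs, fun n => ⟨(hΓ n).1, fun u v huv => h ((hΓ n).2.1 u v huv), (hΓ n).2.2⟩⟩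

theorem sumProdFamilies_subset_VNP1weakPlus : SumProdFamilies F ⊆ VNP1weakPlus F := by
  classical
  rintro f ⟨p, m, ℓ, hp, hm, hℓ, hf⟩
  refine ⟨fun n => ∏ i, ℓ n i, ⟨?_, fun n => ABP.line (ℓ n), ?_, fun n =>
    ⟨ABP.width_line _, ABP.labelsIn_line (hℓ n), ABP.value_line _⟩⟩, p, fun n => n, hp,
    PolyBounded.id, hf⟩
  · refine (hm.mul (PolyBounded.const 2)).of_le fun n => ?_
    refine (Finset.card_le_card (vars_prod (ℓ n))).trans ?_
    refine (Finset.card_biUnion_le_card_mul _ _ 2 fun i _ => ?_).trans (by simp)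
    obtain ⟨α, β, γ, u, v, h⟩ := hℓ n i
    have hsub : (ℓ n i).vars ⊆ {u, v} := by
      rw [h]
      refine (vars_add_subset _ _).trans (Finset.union_subset ((vars_add_subset _ _).trans
        (Finset.union_subset ?_ ?_)) (by simp))
      · refine (vars_mul _ _).trans ?_
        simp [vars_X]
      · refine (vars_mul _ _).trans ?_
        simp [vars_X]
    exact (Finset.card_le_card hsub).trans Finset.card_le_two
  · exact hm.add (PolyBounded.const 1)

/-! ### Circuits for products of affine forms -/

namespace Circuit

/-- A circuit with one more gate. -/
def snoc (Γ : Circuit F) (g : Gate F Γ.size) : Circuit F where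
  size := Γ.size + 1
  gate i := if h : i < Γ.size then Γ.gate ⟨i, h⟩ else
    (show Γ.size = i by omega) ▸ g
  output := Fin.last _

lemma gateValue_snoc_of_lt (Γ : Circuit F) (g : Gate F Γ.size) (n : ℕ) :
    ∀ h : n < Γ.size, (Γ.snoc g).gateValue ⟨n, Nat.lt_succ_of_lt h⟩ = Γ.gateValue ⟨n, h⟩ := by
  induction n using Nat.strong_induction_on with
  | _ n ih =>
    intro h
    have e : (Γ.snoc g).gate ⟨n, Nat.lt_succ_of_lt h⟩ = Γ.gate ⟨n, h⟩ := dif_pos h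
    rw [gateValue, gateValue, e]
    cases Γ.gate ⟨n, h⟩ with
    | const a => rfl
    | var v => rfl
    | add j k => simp only [ih j j.2 (j.2.trans h), ih k k.2 (k.2.trans h)]
    | mul j k => simp only [ih j j.2 (j.2.trans h), ih k k.2 (k.2.trans h)]

lemma gateValue_output_irrel (Γ : Circuit F) (o : Fin Γ.size) (n : ℕ) :
    ∀ h : n < Γ.size, (Circuit.mk Γ.size Γ.gate o).gateValue ⟨n, h⟩ = Γ.gateValue ⟨n, h⟩ := by
  induction n using Nat.strong_induction_on with
  | _ n ih =>
    intro h
    rw [gateValue, gateValue]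
    cases Γ.gate ⟨n, h⟩ with
    | const a => rfl
    | var v => rfl
    | add j k => simp only [ih j j.2 (j.2.trans h), ih k k.2 (k.2.trans h)]
    | mul j k => simp only [ih j j.2 (j.2.trans h), ih k k.2 (k.2.trans h)]

lemma value_snoc (Γ : Circuit F) (g : Gate F Γ.size) :
    (Γ.snoc g).value = match g with
      | .const a => C a
      | .var v => X v
      | .add j k => Γ.gateValue j + Γ.gateValue k
      | .mul j k => Γ.gateValue j * Γ.gateValue k := by
  have e : (Γ.snoc g).gate (Γ.snoc g).output = g := by
    simp [snoc]
  rw [value, gateValue, e]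
  cases g with
  | const a => rfl
  | var v => rfl
  | add j k =>
    exact congrArg₂ (· + ·) (Γ.gateValue_snoc_of_lt _ j j.2)
      (Γ.gateValue_snoc_of_lt _ k k.2)
  | mul j k =>
    exact congrArg₂ (· * ·) (Γ.gateValue_snoc_of_lt _ j j.2)
      (Γ.gateValue_snoc_of_lt _ k k.2)

/-- Some circuit of size `s` has gates for all polynomials in `S`. -/
def ComputableInSize (s : ℕ) (S : Set (MvPolynomial ℕ F)) : Prop :=
  ∃ Γ : Circuit F, Γ.size = s ∧ ∀ f ∈ S, ∃ i, Γ.gateValue i = f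

namespace ComputableInSize

variable {s : ℕ} {S : Set (MvPolynomial ℕ F)}

lemma snoc {Γ : Circuit F} (h : ∀ f ∈ S, ∃ i, Γ.gateValue i = f) (g : Gate F Γ.size)
    {f : MvPolynomial ℕ F} (hf : (Γ.snoc g).value = f) :
    ComputableInSize (Γ.size + 1) (insert f S) := by
  refine ⟨Γ.snoc g, rfl, fun f' hf' => ?_⟩
  rcases hf' with rfl | hf'
  · exact ⟨_, hf⟩
  · obtain ⟨i, rfl⟩ := h f' hf'
    exact ⟨_, Γ.gateValue_snoc_of_lt g i i.2⟩

lemma insert_C (h : ComputableInSize s S) (a : F) : ComputableInSize (s + 1) (insert (C a) S) := by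
  obtain ⟨Γ, rfl, h⟩ := h
  exact snoc h (.const a) (Γ.value_snoc _)

lemma insert_X (h : ComputableInSize s S) (v : ℕ) : ComputableInSize (s + 1) (insert (X v) S) := by
  obtain ⟨Γ, rfl, h⟩ := h
  exact snoc h (.var v) (Γ.value_snoc _)

lemma insert_add (h : ComputableInSize s S) {f g : MvPolynomial ℕ F} (hf : f ∈ S) (hg : g ∈ S) :
    ComputableInSize (s + 1) (insert (f + g) S) := by
  obtain ⟨Γ, rfl, h⟩ := h
  obtain ⟨i, rfl⟩ := h f hf
  obtain ⟨j, rfl⟩ := h g hg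
  exact snoc h (.add i j) (Γ.value_snoc _)

lemma insert_mul (h : ComputableInSize s S) {f g : MvPolynomial ℕ F} (hf : f ∈ S) (hg : g ∈ S) :
    ComputableInSize (s + 1) (insert (f * g) S) := by
  obtain ⟨Γ, rfl, h⟩ := h
  obtain ⟨i, rfl⟩ := h f hf
  obtain ⟨j, rfl⟩ := h g hg
  exact snoc h (.mul i j) (Γ.value_snoc _)

lemma list_prod (l : List (MvPolynomial ℕ F)) (hl : ∀ x ∈ l, x ∈ weakPlusForms F) :
    ∃ S, l.prod ∈ S ∧ ComputableInSize (10 * l.length + 1) S := by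
  induction l with
  | nil =>
    refine ⟨{1}, by simp, ⟨1, fun _ => .const 1, 0⟩, rfl, fun f hf => ⟨0, ?_⟩⟩
    rw [Set.mem_singleton_iff.1 hf, gateValue]
    exact C_1
  | cons x l ih =>
    obtain ⟨S, hS, h⟩ := ih fun y hy => hl y (by simp [hy])
    obtain ⟨α, β, γ, i, j, rfl⟩ := hl x (by simp)
    have h1 := ((h.insert_C α).insert_X i).insert_mul (f := C α) (g := X i) (by simp) (by simp)
    have h2 := ((h1.insert_C β).insert_X j).insert_mul (f := C β) (g := X j) (by simp) (by simp)
    have h3 := (h2.insert_add (f := C α * X i) (g := C β * X j) (by simp) (by simp)).insert_C γ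
    have h4 := h3.insert_add (f := C α * X i + C β * X j) (g := C γ) (by simp) (by simp)
    have h5 := h4.insert_mul (f := C α * X i + C β * X j + C γ) (g := l.prod) (by simp)
      (by simp [hS])
    exact ⟨_, by simp, h5⟩

end ComputableInSize

end Circuit

lemma totalDegree_le_one_of_mem_weakPlusForms {ℓ : MvPolynomial ℕ F} (h : ℓ ∈ weakPlusForms F) :
    ℓ.totalDegree ≤ 1 := by
  obtain ⟨α, β, γ, i, j, rfl⟩ := h
  have hX : ∀ (a : F) (i : ℕ), (C a * X i : MvPolynomial ℕ F).totalDegree ≤ 1 := fun a i =>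
    (totalDegree_mul _ _).trans (by simp)
  refine (totalDegree_add _ _).trans (max_le ((totalDegree_add _ _).trans ?_) (by simp))
  exact max_le (hX _ _) (hX _ _)

lemma VPwidth_one_weakPlusForms_subset_VP : VPwidth 1 (weakPlusForms F) ⊆ VP F := by
  rintro f ⟨hv, Γ, hs, hΓ⟩
  have key : ∀ n, ∃ l : List (MvPolynomial ℕ F), l.length ≤ (Γ n).size ∧
      (∀ x ∈ l, x ∈ weakPlusForms F) ∧ f n = l.prod := by
    intro n
    rw [← (hΓ n).2.2]
    exact ABP.exists_list_of_width_le_one (hΓ n).1 (hΓ n).2.1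
      (weakForms_subset_weakPlusForms zero_mem_weakForms)
  choose l hlen hl hf using key
  refine ⟨hv, hs.of_le fun n => ?_, ?_⟩
  · rw [hf]
    refine (totalDegree_list_prod _).trans ((List.sum_le_card_nsmul _ 1 ?_).trans ?_)
    · simp only [List.mem_map]
      rintro _ ⟨x, hx, rfl⟩
      exact totalDegree_le_one_of_mem_weakPlusForms (hl n x hx)
    · simpa using hlen n
  · have hC : ∀ n, ∃ Δ : Circuit F, Δ.size = 10 * (l n).length + 1 ∧ Δ.value = f n := by
      intro n
      obtain ⟨S, hS, Δ, hΔ, h⟩ := Circuit.ComputableInSize.list_prod (l n) (hl n)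
      obtain ⟨i, hi⟩ := h _ hS
      refine ⟨⟨Δ.size, Δ.gate, i⟩, hΔ, ?_⟩
      rw [hf, ← hi]
      exact Δ.gateValue_output_irrel i i i.2
    choose Δ hsize hval using hC
    refine ⟨Δ, ?_, hval⟩
    refine (((PolyBounded.const 10).mul hs).add (PolyBounded.const 1)).of_le fun n => ?_
    rw [hsize]
    have := hlen n
    omega

/-! ### Univariate forms do not suffice -/

/-- A hypercube sum over a product of univariate forms is a product of a function of `x₀` and a
function of `x₁`, if the other indeterminates are set to `0`. -/
lemma exists_eval_hypercubeSum_eq_mul (p : ℕ) (l : List (MvPolynomial ℕ F))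
    (hl : ∀ x ∈ l, x ∈ weakForms F) : ∃ A B : F → F, ∀ a₀ a₁ : F,
      eval (fun i => if i = 0 then a₀ else if i = 1 then a₁ else 0) (hypercubeSum p l.prod) =
        A a₀ * B a₁ := by
  let ρ : (Fin p → Bool) → F → F → ℕ → F := fun b a₀ a₁ i =>
    if h : i < p then (if b ⟨i, h⟩ then 1 else 0) else
      if i - p = 0 then a₀ else if i - p = 1 then a₁ else 0
  have key : ∃ (A B : F → F) (W : (Fin p → Bool) → F), ∀ b a₀ a₁,
      eval (ρ b a₀ a₁) l.prod = W b * (A a₀ * B a₁) := by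
    induction l with
    | nil => exact ⟨fun _ => 1, fun _ => 1, fun _ => 1, by simp⟩
    | cons x l ih =>
      obtain ⟨A, B, W, h⟩ := ih fun y hy => hl y (by simp [hy])
      obtain ⟨α, β, i, rfl⟩ := hl x (by simp)
      by_cases h0 : i = p
      · refine ⟨fun a => (α * a + β) * A a, B, W, fun b a₀ a₁ => ?_⟩
        simp [h, ρ, h0]
        ring
      · by_cases h1 : i = p + 1
        · refine ⟨A, fun a => (α * a + β) * B a, W, fun b a₀ a₁ => ?_⟩
          simp [h, ρ, h1]
          ring
        · refine ⟨A, B, fun b => (α * ρ b 0 0 i + β) * W b, fun b a₀ a₁ => ?_⟩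
          have hi : ρ b a₀ a₁ i = ρ b 0 0 i := by
            by_cases h2 : i < p
            · simp [ρ, h2]
            · have h3 : i - p ≠ 0 := by omega
              have h4 : i - p ≠ 1 := by omega
              simp [ρ, h2, h3, h4]
          simp [h, hi]
          ring
  obtain ⟨A, B, W, h⟩ := key
  refine ⟨fun a => (∑ b, W b) * A a, B, fun a₀ a₁ => ?_⟩
  rw [mul_assoc, Finset.sum_mul, hypercubeSum, map_sum]
  refine Finset.sum_congr rfl fun b _ => ?_
  rw [← h b a₀ a₁]
  simp only [← aeval_eq_eval]
  rw [aeval_bind₁]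
  congr 2
  funext i
  by_cases hi : i < p
  · by_cases hb : b ⟨i, hi⟩ = true <;> simp [ρ, hi, hb]
  · simp [ρ, hi]

lemma X_add_X_notMem_VNP1weak : (fun _ => X 0 + X 1 : Family F) ∉ VNP1weak F := by
  rintro ⟨g, ⟨-, Γ, -, hΓ⟩, p, q, -, -, hf⟩
  obtain ⟨l, -, hl, hv⟩ := ABP.exists_list_of_width_le_one (hΓ (q 0)).1 (hΓ (q 0)).2.1
    zero_mem_weakForms
  obtain ⟨A, B, h⟩ := exists_eval_hypercubeSum_eq_mul (p 0) l hl
  rw [← hv, (hΓ (q 0)).2.2, ← hf 0] at h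
  have h' : ∀ a₀ a₁, a₀ + a₁ = A a₀ * B a₁ := fun a₀ a₁ => by simpa using h a₀ a₁
  -- A product function satisfies `f(0,1) f(1,0) = f(0,0) f(1,1)`, but the sum does not.
  have : (0 + 1 : F) * (1 + 0) = (0 + 0) * (1 + 1) := by
    rw [h' 0 1, h' 1 0, h' 0 0, h' 1 1]
    ring
  simp at this

lemma X_add_X_mem_sumProdFamilies : (fun _ => X 0 + X 1 : Family F) ∈ SumProdFamilies F :=
  ⟨fun _ => 0, fun _ => 1, fun _ _ => X 0 + X 1, PolyBounded.const 0, PolyBounded.const 1,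
    fun _ _ => ⟨1, 1, 0, 0, 1, by simp⟩, fun _ => by simp [hypercubeSum]⟩

end AlgComplexity

theorem theorem5 (F : Type*) [Field F] (hF : ringChar F ≠ 2) :
    AlgComplexity.VNP1weak F ⊂ AlgComplexity.VNP1weakPlus F ∧
    AlgComplexity.VNP1weakPlus F = AlgComplexity.VNP F ∧
    ∀ f : AlgComplexity.Family F, f ∈ AlgComplexity.VNP F ↔
      ∃ (p m : ℕ → ℕ) (ℓ : (n : ℕ) → Fin (m n) → MvPolynomial ℕ F),
        AlgComplexity.PolyBounded p ∧ AlgComplexity.PolyBounded m ∧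
        (∀ n i, ℓ n i ∈ AlgComplexity.weakPlusForms F) ∧
        ∀ n, f n = AlgComplexity.hypercubeSum (p n) (∏ i, ℓ n i) := by
  open AlgComplexity in
  have h1 : VNP F ⊆ SumProdFamilies F := VNP_subset_sumProdFamilies (Ring.two_ne_zero hF)
  have h2 : SumProdFamilies F ⊆ VNP1weakPlus F := sumProdFamilies_subset_VNP1weakPlus
  have h3 : VNP1weakPlus F ⊆ VNP F := N_mono VPwidth_one_weakPlusForms_subset_VP
  have h4 : VNP1weak F ⊆ VNP1weakPlus F := N_mono (VPwidth_mono 1 weakForms_subset_weakPlusForms)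
  exact ⟨⟨h4, fun h => X_add_X_notMem_VNP1weak (h (h2 X_add_X_mem_sumProdFamilies))⟩,
    h3.antisymm (h1.trans h2), fun f => ⟨fun hf => h1 hf, fun hf => h3 (h2 hf)⟩⟩
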